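/- Let $\mathsf A$ be an abelian category with enough projective objects, and let $\mathsf B\subset\mathsf A$ be a full subcategory closed under kernels and cokernels in $\mathsf A$ (that is, every kernel and every cokernel in $\mathsf A$ of a morphism between objects of $\mathsf B$ belongs to $\mathsf B$). Assume that the fully faithful embedding functor $\mathsf B\to\mathsf A$ has a left adjoint functor $\Delta\colon\mathsf A\to\mathsf B$. Then $\mathsf B$ is an abelian category, the embedding $\mathsf B\to\mathsf A$ is exact, and $\Delta$ is additive and right exact. For $n\ge0$, let $\mathbb L_n\Delta\colon\mathsf A\to\mathsf B$ denote the $n$-th left derived functor of $\Delta$, computed by projective resolutions in $\mathsf A$. For an abelian category $\mathsf C$, let $\mathsf D^-(\mathsf C)$ and $\mathsf D^{\mathrm b}(\mathsf C)$ denote its bounded above and its bounded derived category (cohomological grading). The following four conditions are equivalent: (a) $\mathbb L_n\Delta(P)=0$ for every projective object $P$ of the category $\mathsf B$ (regarded as an object of $\mathsf A$) and all $n\ge1$; (b) $\mathbb L_n\Delta(B)=0$ for every object $B\in\mathsf B$ and all $n\ge1$; (c) the triangulated functor $\mathsf D^-(\mathsf B)\to\mathsf D^-(\mathsf A)$ induced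 by the exact embedding functor $\mathsf B\to\mathsf A$ is fully faithful; (d) the triangulated functor $\mathsf D^{\mathrm b}(\mathsf B)\to\mathsf D^{\mathrm b}(\mathsf A)$ induced by the exact embedding functor $\mathsf B\to\mathsf A$ is fully faithful. -/

import Mathlib

open CategoryTheory CategoryTheory.Limits

universe w₁ w₂ v₁ v₂ u₁ u₂ v u

namespace ReflectiveAbelian

section Subcategory

open scoped ZeroObject

variable {A : Type u} [Category.{v} A] [Abelian A] (B : ObjectProperty A)

/-- A full subcategory closed under kernels is closed under isomorphisms: if `X ≅ Y` with `X` in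
`B`, then `Y` is a kernel of the zero endomorphism of `X`. -/
instance isClosedUnderIsomorphisms [B.IsClosedUnderKernels] : B.IsClosedUnderIsomorphisms where
  of_iso {X Y} e hX := by
    have hk : IsLimit (KernelFork.ofι (f := (0 : X ⟶ X)) e.inv (by simp)) :=
      KernelFork.IsLimit.ofι _ _ (fun g _ => g ≫ e.hom) (fun g _ => by simp)
        (fun g _ m hm => by simp [← hm])
    exact B.prop_of_isLimit_kernelFork hk hX hX

/-- A reflective full subcategory closed under kernels is nonempty, and hence contains the kernel
of an identity morphism, which is a zero object. -/
instance containsZero [B.IsClosedUnderKernels] [Reflective B.ι] : B.ContainsZero where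
  exists_zero := by
    let X : B.FullSubcategory := (reflector B.ι).obj 0
    exact ⟨kernel (𝟙 X.obj), (isZero_zero A).of_iso (kernel.ofMono (𝟙 X.obj)),
      B.prop_kernel _ X.property X.property⟩

/-- A reflective full subcategory closed under isomorphisms is closed under finite products. -/
instance isClosedUnderFiniteProducts [B.IsClosedUnderKernels] [Reflective B.ι] :
    B.IsClosedUnderFiniteProducts where
  isClosedUnderLimitsOfShape J _ := by
    have : HasLimitsOfShape (Discrete J) B.FullSubcategory := hasLimitsOfShape_of_reflective B.ι
    have : PreservesLimitsOfShape (Discrete J) B.ι :=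
      (reflectorAdjunction B.ι).rightAdjoint_preservesLimits.preservesLimitsOfShape
    exact B.isClosedUnderLimitsOfShape_of_preservesLimitsOfShape_ι _

/-- The embedding of a reflective full subcategory is left exact. -/
instance preservesFiniteLimits [Reflective B.ι] : PreservesFiniteLimits B.ι := by
  have : PreservesLimitsOfSize.{0, 0} B.ι :=
    (reflectorAdjunction B.ι).rightAdjoint_preservesLimits
  exact PreservesLimitsOfSize.preservesFiniteLimits B.ι

/-- The embedding of a reflective full subcategory closed under kernels and cokernels is right
exact. -/
instance preservesFiniteColimits [B.IsClosedUnderKernels] [B.IsClosedUnderCokernels]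
    [Reflective B.ι] : PreservesFiniteColimits B.ι := by
  have := B.preservesCokernels_ι
  exact Functor.preservesFiniteColimits_of_preservesCokernels B.ι

/-- The left adjoint of the embedding is additive. -/
instance reflector_additive [B.IsClosedUnderKernels] [B.IsClosedUnderCokernels]
    [Reflective B.ι] : (reflector B.ι).Additive :=
  (reflectorAdjunction B.ι).left_adjoint_additive

end Subcategory

section Derived

open DerivedCategory

variable {C₁ : Type u₁} [Category.{v₁} C₁] [Abelian C₁] [HasDerivedCategory.{w₁} C₁]
  {C₂ : Type u₂} [Category.{v₂} C₂] [Abelian C₂] [HasDerivedCategory.{w₂} C₂]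
  (F : C₁ ⥤ C₂) [F.Additive] [PreservesFiniteLimits F] [PreservesFiniteColimits F]

/-- The functor between derived categories induced by an exact functor preserves complexes whose
cohomology is concentrated in degrees `≤ n`. -/
theorem isLE_mapDerivedCategory (X : DerivedCategory C₁) (n : ℤ) (h : TStructure.t.IsLE X n) :
    TStructure.t.IsLE (F.mapDerivedCategory.obj X) n := by
  obtain ⟨K, hK, ⟨e⟩⟩ := X.exists_iso_Q_obj_of_isLE n
  exact ⟨⟨(F.mapHomologicalComplex (ComplexShape.up ℤ)).obj K,
    F.mapDerivedCategory.mapIso e ≪≫ F.mapDerivedCategoryFactors.app K, inferInstance⟩⟩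

/-- The functor between derived categories induced by an exact functor preserves complexes whose
cohomology is concentrated in degrees `≥ n`. -/
theorem isGE_mapDerivedCategory (X : DerivedCategory C₁) (n : ℤ) (h : TStructure.t.IsGE X n) :
    TStructure.t.IsGE (F.mapDerivedCategory.obj X) n := by
  obtain ⟨K, hK, ⟨e⟩⟩ := X.exists_iso_Q_obj_of_isGE n
  exact ⟨⟨(F.mapHomologicalComplex (ComplexShape.up ℤ)).obj K,
    F.mapDerivedCategory.mapIso e ≪≫ F.mapDerivedCategoryFactors.app K, inferInstance⟩⟩

/-- The functor `D⁻(C₁) ⥤ D⁻(C₂)` induced by an exact functor `F : C₁ ⥤ C₂`. -/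
noncomputable def mapDerivedMinus : DerivedCategory.Minus C₁ ⥤ DerivedCategory.Minus C₂ :=
  ObjectProperty.lift _ (Minus.ι ⋙ F.mapDerivedCategory)
    (fun X => X.property.elim fun n hn => ⟨n, isLE_mapDerivedCategory F X.obj n hn⟩)

/-- The functor `Dᵇ(C₁) ⥤ Dᵇ(C₂)` induced by an exact functor `F : C₁ ⥤ C₂`. -/
noncomputable def mapDerivedBounded : DerivedCategory.Bounded C₁ ⥤ DerivedCategory.Bounded C₂ :=
  ObjectProperty.lift _ (Bounded.ι ⋙ F.mapDerivedCategory)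
    (fun X => ⟨X.property.1.elim fun n hn => ⟨n, isGE_mapDerivedCategory F X.obj n hn⟩,
      X.property.2.elim fun n hn => ⟨n, isLE_mapDerivedCategory F X.obj n hn⟩⟩)

end Derived

end ReflectiveAbelian

-- Write `F` for the embedding and `G` for its left adjoint. All four conditions are compared with
-- (*): `Ext` in A of positive degree vanishes from projectives of B to objects of B. (a) gives (*):
-- if `R` resolves `P` in A, then `G R` resolves `P` in B, and Hom(R, Y) = Hom(G R, Y), so the `Ext`
-- groups of A and B agree (`subsingleton_ext_of_isZero_leftDerived`). (*) gives (b) and (c):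
-- replace a bounded above complex of B by projectives `E` of B, then `F E` by projectives `Q` of A.
-- The cone of `Q ⟶ F E` is acyclic with Hom(-, Y)-acyclic terms, so `G` keeps it acyclic and the
-- unit `Q ⟶ F G Q` is a quasi-isomorphism (`exists_projective_quasiIso`). Maps out of `G Q` and `Q`
-- are homotopy classes of chain maps, which the adjunction identifies. (d) gives (*): by fullness
-- every `Ext` class in A from `P` comes from B, where it is zero.

universe w

/-! ### Bounded above complexes: projective resolutions, acyclicity for Hom, cones -/

namespace CochainComplex

variable {C : Type u} [Category.{v} C] [Abelian C]

open Opposite in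
lemma quasiIso_of_quasiIso_opEquivalence_functor_map {K L : CochainComplex C ℤ} (f : K ⟶ L)
    (hf : QuasiIso ((opEquivalence C).functor.map f.op)) : QuasiIso f := by
  refine ⟨fun n => ?_⟩
  have h := hf.quasiIsoAt (-n)
  rw [quasiIsoAt_iff' _ (-(n + 1)) (-n) (-(n - 1)) (by simp; lia) (by simp; lia)] at h
  rw [← neg_neg n, quasiIsoAt_iff' _ (- -(n - 1)) (- - n) (- -(n + 1)) (by simp) (by simp)]
  exact (ShortComplex.quasiIso_opMap_iff _).1 h

open Opposite in
/-- In an abelian category with enough projectives, a bounded above complex admits a resolution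
by a bounded above complex of projective objects. -/
lemma exists_quasiIso_projective [EnoughProjectives C] (K : CochainComplex C ℤ) (N : ℤ)
    [K.IsStrictlyLE N] :
    ∃ (Q : CochainComplex C ℤ) (p : Q ⟶ K), QuasiIso p ∧ (∀ n, Projective (Q.X n)) ∧
      Q.IsStrictlyLE N := by
  -- Injective resolutions in the opposite category, with the grading negated.
  let e := opEquivalence C
  have : (e.functor.obj (op K)).IsStrictlyGE (-N) := by
    rw [isStrictlyGE_iff]
    intro i hi
    exact (K.isZero_of_isStrictlyLE N (-i) (by lia)).op
  obtain ⟨L, i, hi, hL, hL'⟩ :=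
    Plus.modelCategoryQuillen.exists_quasiIso_injective (e.functor.obj (op K)) (-N)
  obtain ⟨f, hf⟩ := e.functor.map_surjective (i ≫ (e.counitIso.app L).inv)
  let φ : e.functor.obj (e.inverse.obj L) ≅ L := e.counitIso.app L
  have hiso : ∀ n, Nonempty ((e.functor.obj (e.inverse.obj L)).X n ≅ L.X n) := fun n =>
    ⟨(HomologicalComplex.eval _ _ n).mapIso φ⟩
  have hX : ∀ n, Nonempty (op ((e.inverse.obj L).unop.X n) ≅ L.X (-n)) := fun n => by
    have := hiso (-n)
    change Nonempty (op ((e.inverse.obj L).unop.X (- -n)) ≅ L.X (-n)) at this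
    rwa [neg_neg] at this
  refine ⟨(e.inverse.obj L).unop, f.unop, ?_, fun n => ?_, ?_⟩
  · apply quasiIso_of_quasiIso_opEquivalence_functor_map
    change QuasiIso (e.functor.map f)
    rw [hf]
    infer_instance
  · obtain ⟨ψ⟩ := hX n
    have : Injective (op ((e.inverse.obj L).unop.X n)) := Injective.of_iso ψ.symm (hL _)
    exact Injective.projective_iff_injective_op.2 this
  · rw [isStrictlyLE_iff]
    intro n hn
    obtain ⟨ψ⟩ := hX n
    exact ((L.isZero_of_isStrictlyGE (-N) (-n) (by lia)).of_iso ψ).unop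

lemma shortExact_iCycles_toCycles (K : CochainComplex C ℤ) (i j : ℤ) (hij : i + 1 = j)
    (hK : K.ExactAt j) :
    (ShortComplex.mk (K.iCycles i) (K.toCycles i j) (by
      rw [← cancel_mono (K.iCycles j)]; simp)).ShortExact where
  exact := by
    have h : (ShortComplex.mk (K.iCycles i) (K.d i j) (by simp)).Exact :=
      ShortComplex.exact_of_f_is_kernel _ (K.cyclesIsKernel i j (by simp [hij]))
    have w : K.iCycles i ≫ K.toCycles i j = 0 := by
      rw [← cancel_mono (K.iCycles j)]; simp
    let φ : ShortComplex.mk (K.iCycles i) (K.toCycles i j) w ⟶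
        ShortComplex.mk (K.iCycles i) (K.d i j) (by simp) :=
      { τ₁ := 𝟙 _, τ₂ := 𝟙 _, τ₃ := K.iCycles j }
    have : Epi φ.τ₁ := inferInstanceAs (Epi (𝟙 _))
    have : IsIso φ.τ₂ := inferInstanceAs (IsIso (𝟙 _))
    have : Mono φ.τ₃ := inferInstanceAs (Mono (K.iCycles j))
    exact (ShortComplex.exact_iff_of_epi_of_isIso_of_mono φ).2 h
  mono_f := by dsimp; infer_instance
  epi_g := by
    obtain rfl : (ComplexShape.up ℤ).prev j = i := by simp [← hij]
    exact ShortComplex.Exact.epi_toCycles hK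

open Abelian in
/-- If a bounded above acyclic complex consists of objects that are acyclic for `Hom(-, T)`,
then its image under `Hom(-, T)` is exact. -/
lemma exists_d_comp_eq_of_subsingleton_ext [HasExt.{w₁} C] (K : CochainComplex C ℤ) (N : ℤ)
    [K.IsStrictlyLE N] (hK : K.Acyclic) (T : C)
    (hT : ∀ (i : ℤ) (k : ℕ), Subsingleton (Ext (K.X i) T (k + 1)))
    {l n m : ℤ} (hl : l + 1 = n) (hm : n + 1 = m) (c : K.X n ⟶ T) (hc : K.d l n ≫ c = 0) :
    ∃ g : K.X m ⟶ T, K.d n m ≫ g = c := by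
  -- Dimension shifting along 0 ⟶ Zⁱ ⟶ Kⁱ ⟶ Zⁱ⁺¹ ⟶ 0, starting above `N`, where the cycles vanish.
  have hZ : ∀ (d : ℕ) (i : ℤ), N < i + d → ∀ k : ℕ, Subsingleton (Ext (K.cycles i) T (k + 1)) := by
    intro d
    induction d with
    | zero =>
      intro i hi k
      have h0 : IsZero (K.X i) := K.isZero_of_isStrictlyLE N i (by simpa using hi)
      have h1 : IsZero (K.cycles i) := IsZero.of_mono (K.iCycles i) h0
      have : Projective (K.cycles i) := h1.projective
      exact Ext.subsingleton_of_projective _ _ _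
    | succ d hd =>
      intro i hi k
      have hS := K.shortExact_iCycles_toCycles i (i + 1) rfl (hK _)
      refine subsingleton_of_forall_eq 0 fun x => ?_
      have := hd (i + 1) (by push_cast at hi; lia) (k + 1)
      obtain ⟨y, rfl⟩ := Ext.contravariant_sequence_exact₁ hS _ x (Nat.add_comm 1 (k + 1))
        (Subsingleton.elim _ _)
      have := hT i k
      rw [Subsingleton.elim y 0, Ext.comp_zero]
  have hS := K.shortExact_iCycles_toCycles n m hm (hK _)
  have hS' := K.shortExact_iCycles_toCycles m (m + 1) rfl (hK _)
  have hc' : K.iCycles n ≫ c = 0 := by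
    have := (K.shortExact_iCycles_toCycles l n hl (hK _)).epi_g
    dsimp at this
    rw [← cancel_epi (K.toCycles l n)]
    simpa using hc
  have := hS.epi_g
  let c' : K.cycles m ⟶ T := hS.exact.desc c hc'
  have hcc : K.toCycles n m ≫ c' = c := hS.exact.g_desc c hc'
  -- The obstruction to extending `c'` from the cycles to `K.X m` lies in an `Ext` group of degree
  -- 1, which is zero.
  have := hZ (N - m).toNat (m + 1) (by lia) 0
  obtain ⟨y, hy⟩ := Ext.contravariant_sequence_exact₁ hS' T (Ext.mk₀ c') rfl
    (Subsingleton.elim _ _)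
  obtain ⟨g, rfl⟩ := Ext.homEquiv₀.symm.surjective y
  refine ⟨g, ?_⟩
  replace hy : K.iCycles m ≫ g = c' := by
    change (Ext.mk₀ _).comp (Ext.mk₀ g) _ = _ at hy
    rw [Ext.mk₀_comp_mk₀] at hy
    exact Ext.homEquiv₀.symm.injective hy
  rw [← hcc, ← hy, HomologicalComplex.toCycles_i_assoc]

lemma quasiIso_iff_acyclic_mappingCone {K L : CochainComplex C ℤ} (f : K ⟶ L) :
    QuasiIso f ↔ (mappingCone f).Acyclic := by
  rw [← HomotopyCategory.quotient_obj_mem_subcategoryAcyclic_iff_acyclic,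
    ← HomologicalComplex.mem_quasiIso_iff, ← HomotopyCategory.quotient_map_mem_quasiIso_iff,
    HomotopyCategory.quasiIso_eq_trW_subcategoryAcyclic]
  exact (HomotopyCategory.subcategoryAcyclic C).trW_iff_of_distinguished _
    (HomotopyCategory.mappingCone_triangleh_distinguished f)

open Abelian in
-- The identity of a term of the cone is a sum of two maps, one factoring through a term of `K` and
-- one through a term of `L`.
lemma subsingleton_ext_mappingCone_X [HasExt.{w₁} C] {K L : CochainComplex C ℤ} (f : K ⟶ L)
    (T : C) (n : ℕ) (hK : ∀ i, Subsingleton (Ext (K.X i) T n))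
    (hL : ∀ i, Subsingleton (Ext (L.X i) T n)) (i : ℤ) :
    Subsingleton (Ext ((mappingCone f).X i) T n) := by
  refine subsingleton_of_forall_eq 0 fun x => ?_
  have := hK (i + 1)
  have := hL i
  rw [← Ext.mk₀_id_comp x, ← mappingCone.id_X f i (i + 1) rfl, Ext.mk₀_add, Ext.add_comp,
    ← Ext.mk₀_comp_mk₀_assoc, ← Ext.mk₀_comp_mk₀_assoc,
    Subsingleton.elim ((Ext.mk₀ ((mappingCone.inl f).v (i + 1) i (by lia))).comp x _) 0,
    Subsingleton.elim ((Ext.mk₀ ((mappingCone.inr f).f i)).comp x _) 0]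
  simp

instance isStrictlyLE_mappingCone {K L : CochainComplex C ℤ} (f : K ⟶ L) (N : ℤ)
    [K.IsStrictlyLE N] [L.IsStrictlyLE N] : (mappingCone f).IsStrictlyLE N := by
  rw [isStrictlyLE_iff]
  intro i hi
  rw [mappingCone.isZero_X_iff]
  exact ⟨K.isZero_of_isStrictlyLE N _ (by lia), L.isZero_of_isStrictlyLE N _ hi⟩

end CochainComplex

/-- It suffices to test the cokernel projection of `S.f`: if it factors through `S.g`, it kills the
kernel of `S.g`. -/
lemma CategoryTheory.ShortComplex.exact_of_forall_exists_comp_eq {C : Type u} [Category.{v} C]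
    [Abelian C] (S : ShortComplex C)
    (h : ∀ (Y : C) (c : S.X₂ ⟶ Y), S.f ≫ c = 0 → ∃ g : S.X₃ ⟶ Y, S.g ≫ g = c) : S.Exact := by
  obtain ⟨g, hg⟩ := h _ (cokernel.π S.f) (cokernel.condition _)
  rw [S.exact_iff_kernel_ι_comp_cokernel_π_zero, ← hg, kernel.condition_assoc, zero_comp]

namespace CategoryTheory

/-- The adjunction on homological complexes that is induced by an adjunction between additive
functors. -/
@[simps! unit_app_f counit_app_f]
def Adjunction.mapHomologicalComplex {C : Type u₁} [Category.{v₁} C] [Preadditive C]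
    {D : Type u₂} [Category.{v₂} D] [Preadditive D] {G : C ⥤ D} {F : D ⥤ C} (adj : G ⊣ F)
    [G.Additive] [F.Additive] {ι : Type*} (c : ComplexShape ι) :
    G.mapHomologicalComplex c ⊣ F.mapHomologicalComplex c where
  unit :=
    { app := fun K =>
        { f := fun i => adj.unit.app (K.X i)
          comm' := fun i j _ => (adj.unit.naturality (K.d i j)).symm }
      naturality := fun K L f => by ext i; exact adj.unit.naturality (f.f i) }
  counit :=
    { app := fun K =>
        { f := fun i => adj.counit.app (K.X i)
          comm' := fun i j _ => (adj.counit.naturality (K.d i j)).symm }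
      naturality := fun K L f => by ext i; exact adj.counit.naturality (f.f i) }
  left_triangle_components K := by
    ext i; exact adj.left_triangle_components (K.X i)
  right_triangle_components K := by
    ext i; exact adj.right_triangle_components (K.X i)

end CategoryTheory

/-! ### Maps out of K-projective complexes: chain maps up to homotopy -/

namespace CochainComplex.IsKProjective

open DerivedCategory

variable {C : Type u} [Category.{v} C] [Abelian C] [HasDerivedCategory.{w₁} C]

lemma Q_map_surjective (K L : CochainComplex C ℤ) [K.IsKProjective] :
    Function.Surjective (fun f : K ⟶ L => Q.map f) := by
  intro f
  obtain ⟨g, hg⟩ := (Qh_map_bijective K ((HomotopyCategory.quotient _ _).obj L)).surjective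
    ((quotientCompQhIso C).hom.app K ≫ f ≫ (quotientCompQhIso C).inv.app L)
  obtain ⟨g, rfl⟩ := (HomotopyCategory.quotient _ _).map_surjective g
  refine ⟨g, ?_⟩
  rw [← cancel_epi ((quotientCompQhIso C).hom.app K), ← quotientCompQhIso_hom_naturality, hg]
  simp

lemma nonempty_homotopy_of_Q_map_eq {K L : CochainComplex C ℤ} [K.IsKProjective] {f g : K ⟶ L}
    (h : Q.map f = Q.map g) : Nonempty (Homotopy f g) := by
  refine ⟨HomotopyCategory.homotopyOfEq _ _ ((Qh_map_bijective K _).injective ?_)⟩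
  rw [← cancel_mono ((quotientCompQhIso C).hom.app L), quotientCompQhIso_hom_naturality,
    quotientCompQhIso_hom_naturality, h]

end CochainComplex.IsKProjective

/-! ### Full faithfulness on maps out of `G K` -/

section

open DerivedCategory

variable {A : Type u₁} [Category.{v₁} A] [Abelian A] [HasDerivedCategory.{w₁} A]
  {B : Type u₂} [Category.{v₂} B] [Abelian B] [HasDerivedCategory.{w₂} B]
  {F : B ⥤ A} {G : A ⥤ B} (adj : G ⊣ F) [F.Additive] [G.Additive]
  [PreservesFiniteLimits F] [PreservesFiniteColimits F]

include adj in
-- Both `K` and its image under `G` are K-projective, so both sides are homotopy classes of chain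
-- maps. The adjunction matches these, and the unit becomes invertible in the derived category.
lemma CategoryTheory.Adjunction.mapDerivedCategory_map_bijective (K : CochainComplex A ℤ)
    [K.IsKProjective] [CochainComplex.IsKProjective ((G.mapHomologicalComplex (.up ℤ)).obj K)]
    (hK : QuasiIso ((adj.mapHomologicalComplex (.up ℤ)).unit.app K)) (Y : DerivedCategory B) :
    Function.Bijective (F.mapDerivedCategory.map :
      (Q.obj ((G.mapHomologicalComplex (.up ℤ)).obj K) ⟶ Y) → _) := by
  let adj' := adj.mapHomologicalComplex (.up ℤ)
  let e := F.mapDerivedCategoryFactors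
  obtain ⟨L, ⟨eL⟩⟩ : ∃ L, Nonempty (Q.obj L ≅ Y) := ⟨_, ⟨Q.objObjPreimageIso Y⟩⟩
  have : IsIso (Q.map (adj'.unit.app K)) := (isIso_Q_map_iff_quasiIso _ (adj'.unit.app K)).2 hK
  have hQ : ∀ f : (G.mapHomologicalComplex (.up ℤ)).obj K ⟶ L,
      Q.map (adj'.unit.app K) ≫ e.inv.app _ ≫ F.mapDerivedCategory.map (Q.map f) ≫ e.hom.app L =
        Q.map (adj'.homEquiv _ _ f) := fun f => by
    dsimp only [e]
    rw [F.mapDerivedCategoryFactors_hom_naturality, Iso.inv_hom_id_app_assoc, ← Q.map_comp]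
    rfl
  constructor
  · intro f g hfg
    obtain ⟨f', hf'⟩ := CochainComplex.IsKProjective.Q_map_surjective _ _ (f ≫ eL.inv)
    obtain ⟨g', hg'⟩ := CochainComplex.IsKProjective.Q_map_surjective _ _ (g ≫ eL.inv)
    dsimp only at hf' hg'
    have h : Q.map (adj'.homEquiv _ _ f') = Q.map (adj'.homEquiv _ _ g') := by
      rw [← hQ, ← hQ, hf', hg', F.mapDerivedCategory.map_comp, F.mapDerivedCategory.map_comp, hfg]
    obtain ⟨H⟩ := CochainComplex.IsKProjective.nonempty_homotopy_of_Q_map_eq h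
    -- Passing to adjoint maps respects homotopies: apply `G`, then compose with the counit.
    have H' := (G.mapHomotopy H).compRight (adj'.counit.app L)
    have hadj : ∀ k : (G.mapHomologicalComplex (.up ℤ)).obj K ⟶ L,
        (G.mapHomologicalComplex (.up ℤ)).map (adj'.homEquiv _ _ k) ≫ adj'.counit.app L = k :=
      fun k => (adj'.homEquiv_counit _ _ _).symm.trans (Equiv.symm_apply_apply _ _)
    have h' : Q.map f' = Q.map g' := by
      have := Q_map_eq_of_homotopy _ H'
      rwa [hadj, hadj] at this
    rw [← cancel_mono eL.inv, ← hf', ← hg', h']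
  · intro g
    obtain ⟨g', hg'⟩ := CochainComplex.IsKProjective.Q_map_surjective K _
      (Q.map (adj'.unit.app K) ≫ e.inv.app _ ≫ g ≫ F.mapDerivedCategory.map eL.inv ≫ e.hom.app L)
    dsimp only at hg'
    refine ⟨Q.map ((adj'.homEquiv _ _).symm g') ≫ eL.hom, ?_⟩
    have := hQ ((adj'.homEquiv _ _).symm g')
    rw [Equiv.apply_symm_apply, hg', cancel_epi, cancel_epi, ← Category.assoc,
      cancel_mono] at this
    rw [F.mapDerivedCategory.map_comp, this, Category.assoc, ← F.mapDerivedCategory.map_comp]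
    simp

end

/-! ### Acyclicity and quasi-isomorphisms preserved by the left adjoint -/

section

open Abelian

variable {A : Type u₁} [Category.{v₁} A] [Abelian A]
  {B : Type u₂} [Category.{v₂} B] [Abelian B]
  {F : B ⥤ A} {G : A ⥤ B} (adj : G ⊣ F) [F.Additive] [G.Additive]

include adj in
-- Exactness in B is tested by maps into all `Y`, and by adjunction these are maps from `K` into
-- `F.obj Y`.
lemma CategoryTheory.Adjunction.acyclic_map_of_subsingleton_ext [HasExt.{w₁} A]
    (K : CochainComplex A ℤ) (N : ℤ)
    [K.IsStrictlyLE N] (hK : K.Acyclic)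
    (h : ∀ (i : ℤ) (Y : B) (n : ℕ), Subsingleton (Ext (K.X i) (F.obj Y) (n + 1))) :
    ((G.mapHomologicalComplex (.up ℤ)).obj K).Acyclic := by
  intro n
  rw [HomologicalComplex.exactAt_iff' _ (n - 1) n (n + 1) (by simp) (by simp)]
  apply ShortComplex.exact_of_forall_exists_comp_eq
  intro Y c hc
  change G.obj (K.X n) ⟶ Y at c
  replace hc : G.map (K.d (n - 1) n) ≫ c = 0 := hc
  obtain ⟨g, hg⟩ := K.exists_d_comp_eq_of_subsingleton_ext N hK (F.obj Y) (fun i k => h i Y k)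
    (l := n - 1) (by lia) (m := n + 1) rfl (adj.homEquiv _ _ c) (by
      rw [← adj.homEquiv_naturality_left, hc]; simp [adj.homEquiv_unit])
  refine ⟨(adj.homEquiv _ _).symm g, ?_⟩
  change G.map (K.d n (n + 1)) ≫ _ = c
  rw [← adj.homEquiv_naturality_left_symm, hg, Equiv.symm_apply_apply]

variable [F.Full] [F.Faithful]

lemma CategoryTheory.Adjunction.quasiIso_homEquiv_symm [HasExt.{w₁} A] (N : ℤ)
    {Q : CochainComplex A ℤ} [Q.IsStrictlyLE N] [∀ i, Projective (Q.X i)]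
    {E : CochainComplex B ℤ} [E.IsStrictlyLE N]
    (hE : ∀ (i : ℤ) (Y : B) (n : ℕ), Subsingleton (Ext (F.obj (E.X i)) (F.obj Y) (n + 1)))
    (p : Q ⟶ (F.mapHomologicalComplex (.up ℤ)).obj E) (hp : QuasiIso p) :
    QuasiIso (((adj.mapHomologicalComplex (.up ℤ)).homEquiv _ _).symm p) := by
  have : CochainComplex.IsStrictlyLE ((F.mapHomologicalComplex (.up ℤ)).obj E) N := by
    rw [CochainComplex.isStrictlyLE_iff]
    exact fun i hi => F.map_isZero (E.isZero_of_isStrictlyLE N i hi)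
  have h := adj.acyclic_map_of_subsingleton_ext (CochainComplex.mappingCone p) N
    ((CochainComplex.quasiIso_iff_acyclic_mappingCone p).1 hp) (fun i Y n =>
      CochainComplex.subsingleton_ext_mappingCone_X p _ _
        (fun i => Ext.subsingleton_of_projective _ _ _) (fun i => hE i Y n) i)
  have h' : QuasiIso ((G.mapHomologicalComplex (.up ℤ)).map p) := by
    rw [CochainComplex.quasiIso_iff_acyclic_mappingCone]
    exact fun n => (h n).of_iso (CochainComplex.mappingCone.mapHomologicalComplexIso p G)
  -- Since `F` is fully faithful, the counit is an isomorphism, so the adjoint of `p` is `G` applied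
  -- to `p` up to isomorphism.
  have (i : ℤ) : IsIso (((adj.mapHomologicalComplex (.up ℤ)).counit.app E).f i) := by
    dsimp; infer_instance
  have : IsIso ((adj.mapHomologicalComplex (.up ℤ)).counit.app E) :=
    HomologicalComplex.Hom.isIso_of_components _
  rw [Adjunction.homEquiv_counit]
  infer_instance

end

/-! ### Consequences of `Ext` vanishing: full faithfulness and derived functors -/

section

open Abelian

variable {A : Type u₁} [Category.{v₁} A] [Abelian A]
  {B : Type u₂} [Category.{v₂} B] [Abelian B]
  {F : B ⥤ A} {G : A ⥤ B} (adj : G ⊣ F)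

omit [Abelian A] [Abelian B] in
include adj in
lemma CategoryTheory.Adjunction.enoughProjectives_of_fullyFaithful [EnoughProjectives A]
    [F.Full] [F.Faithful] [F.PreservesEpimorphisms] : EnoughProjectives B where
  presentation X := ⟨
    { p := G.obj (Projective.over (F.obj X))
      projective := adj.map_projective _ inferInstance
      f := G.map (Projective.π (F.obj X)) ≫ adj.counit.app X
      epi := by
        have : G.PreservesEpimorphisms := Functor.preservesEpimorphisms_of_adjunction adj
        infer_instance }⟩

variable [F.Additive] [G.Additive] [PreservesFiniteLimits F] [PreservesFiniteColimits F]

variable [F.Full] [F.Faithful] [EnoughProjectives A]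

lemma CategoryTheory.Adjunction.exists_projective_quasiIso [HasExt.{w} A]
    (hF : ∀ P : B, Projective P → ∀ (Y : B) (n : ℕ),
      Subsingleton (Ext (F.obj P) (F.obj Y) (n + 1)))
    (K : CochainComplex B ℤ) (N : ℤ) [K.IsStrictlyLE N] :
    ∃ (Q : CochainComplex A ℤ) (q : (G.mapHomologicalComplex (.up ℤ)).obj Q ⟶ K),
      Q.IsStrictlyLE N ∧ (∀ i, Projective (Q.X i)) ∧ QuasiIso q ∧
      QuasiIso ((adj.mapHomologicalComplex (.up ℤ)).homEquiv _ _ q) ∧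
      QuasiIso ((adj.mapHomologicalComplex (.up ℤ)).unit.app Q) := by
  let adj' := adj.mapHomologicalComplex (.up ℤ)
  have := adj.enoughProjectives_of_fullyFaithful
  obtain ⟨E, e, he, hE, hEN⟩ := K.exists_quasiIso_projective N
  have : CochainComplex.IsStrictlyLE ((F.mapHomologicalComplex (.up ℤ)).obj E) N := by
    rw [CochainComplex.isStrictlyLE_iff]
    exact fun i hi => F.map_isZero (E.isZero_of_isStrictlyLE N i hi)
  obtain ⟨Q, p, hp, hQ, hQN⟩ :=
    CochainComplex.exists_quasiIso_projective ((F.mapHomologicalComplex (.up ℤ)).obj E) N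
  have h := adj.quasiIso_homEquiv_symm N (fun i => hF _ (hE i)) p hp
  have h₁ : adj'.homEquiv _ _ ((adj'.homEquiv _ _).symm p ≫ e) =
      p ≫ (F.mapHomologicalComplex (.up ℤ)).map e := by
    rw [adj'.homEquiv_naturality_right, Equiv.apply_symm_apply]
  have h₂ : adj'.unit.app Q ≫
      (F.mapHomologicalComplex (.up ℤ)).map ((adj'.homEquiv _ _).symm p) = p :=
    (adj'.homEquiv_unit _ _ _).symm.trans (Equiv.apply_symm_apply _ _)
  refine ⟨Q, (adj'.homEquiv _ _).symm p ≫ e, hQN, hQ, inferInstance, ?_, ?_⟩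
  · change QuasiIso (adj'.homEquiv _ _ ((adj'.homEquiv _ _).symm p ≫ e))
    rw [h₁]
    infer_instance
  -- Two out of three: `p` is the unit followed by `F` of a quasi-isomorphism.
  · rw [← h₂] at hp
    exact quasiIso_of_comp_right _
      ((F.mapHomologicalComplex (.up ℤ)).map ((adj'.homEquiv _ _).symm p))

open DerivedCategory in
include adj in
lemma CategoryTheory.Adjunction.mapDerivedCategory_map_bijective_of_isLE [HasExt.{w} A]
    [HasDerivedCategory.{w₁} A] [HasDerivedCategory.{w₂} B]
    (hF : ∀ P : B, Projective P → ∀ (Y : B) (n : ℕ),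
      Subsingleton (Ext (F.obj P) (F.obj Y) (n + 1)))
    (X Y : DerivedCategory B) (N : ℤ) [X.IsLE N] :
    Function.Bijective (F.mapDerivedCategory.map : (X ⟶ Y) → _) := by
  obtain ⟨K, hK, ⟨e⟩⟩ := X.exists_iso_Q_obj_of_isLE N
  obtain ⟨P, q, hPN, hP, hq, -, h⟩ := adj.exists_projective_quasiIso hF K N
  have : CochainComplex.IsStrictlyLE ((G.mapHomologicalComplex (.up ℤ)).obj P) N := by
    rw [CochainComplex.isStrictlyLE_iff]
    exact fun i hi => G.map_isZero (P.isZero_of_isStrictlyLE N i hi)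
  have (i : ℤ) : Projective (((G.mapHomologicalComplex (.up ℤ)).obj P).X i) :=
    adj.map_projective _ (hP i)
  have := CochainComplex.isKProjective_of_projective P N
  have := CochainComplex.isKProjective_of_projective
    ((G.mapHomologicalComplex (.up ℤ)).obj P) N
  let e' : Q.obj ((G.mapHomologicalComplex (.up ℤ)).obj P) ≅ X := asIso (Q.map q) ≪≫ e.symm
  have hbij := adj.mapDerivedCategory_map_bijective P h Y
  constructor
  · intro f g hfg
    rw [← cancel_epi e'.hom]
    exact hbij.injective (by rw [Functor.map_comp, hfg, Functor.map_comp])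
  · intro g
    obtain ⟨f, hf⟩ := hbij.surjective (F.mapDerivedCategory.map e'.hom ≫ g)
    exact ⟨e'.inv ≫ f, by rw [Functor.map_comp, hf, ← Functor.map_comp_assoc]; simp⟩

/-- A left derived functor vanishes on an object iff the image of a projective resolution of this
object is exact in the corresponding degree. -/
lemma CategoryTheory.ProjectiveResolution.isZero_leftDerived_obj_iff {X : A}
    (R : ProjectiveResolution X) (G : A ⥤ B) [G.Additive] (n : ℕ) :
    IsZero ((G.leftDerived n).obj X) ↔
      ((G.mapHomologicalComplex (.down ℕ)).obj R.complex).ExactAt n := by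
  rw [HomologicalComplex.exactAt_iff_isZero_homology]
  exact (R.isoLeftDerivedObj G n).isZero_iff

include adj in
-- For `X` in degree 0, the resolution `Q` of `F.obj X` has `G Q` quasi-isomorphic to `X`. Any other
-- projective resolution is homotopy equivalent to `Q`, so `G` sends it to a complex with the same
-- cohomology.
lemma CategoryTheory.Adjunction.isZero_leftDerived_obj [HasExt.{w} A]
    (hF : ∀ P : B, Projective P → ∀ (Y : B) (n : ℕ),
      Subsingleton (Ext (F.obj P) (F.obj Y) (n + 1)))
    (X : B) (n : ℕ) : IsZero ((G.leftDerived (n + 1)).obj (F.obj X)) := by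
  let := HasDerivedCategory.standard A
  let R := projectiveResolution (F.obj X)
  rw [R.isZero_leftDerived_obj_iff]
  obtain ⟨Q, q, hQN, hQ, hq, hp, -⟩ :=
    adj.exists_projective_quasiIso hF ((CochainComplex.singleFunctor B 0).obj X) 0
  have := Q.isKProjective_of_projective 0
  let p : Q ⟶ (CochainComplex.singleFunctor A 0).obj (F.obj X) :=
    (adj.mapHomologicalComplex (.up ℤ)).homEquiv _ _ q ≫
      (F.mapCochainComplexSingleFunctor 0).hom.app X
  have hp' : QuasiIso p := by dsimp only [p]; infer_instance
  obtain ⟨s, hs⟩ := CochainComplex.IsKProjective.Q_map_surjective R.cochainComplex Q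
    (DerivedCategory.Q.map R.π' ≫ inv (DerivedCategory.Q.map p))
  have hs' : QuasiIso s := by
    rw [← DerivedCategory.isIso_Q_map_iff_quasiIso]
    dsimp only at hs
    rw [hs]
    infer_instance
  obtain ⟨e, he⟩ := (CochainComplex.IsKProjective.quasiIso_iff s).1 hs'
  have hGs : QuasiIso ((G.mapHomologicalComplex (.up ℤ)).map s ≫ q) := by
    have : QuasiIso ((G.mapHomologicalComplex (.up ℤ)).map s) := by
      rw [← he]
      exact (G.mapHomotopyEquiv e).quasiIso_hom
    infer_instance
  have h : HomologicalComplex.ExactAt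
      ((G.mapHomologicalComplex (.up ℤ)).obj R.cochainComplex) (-(n + 1)) := by
    rw [← quasiIsoAt_iff_exactAt' ((G.mapHomologicalComplex (.up ℤ)).map s ≫ q)]
    · infer_instance
    · exact CochainComplex.exactAt_of_isGE _ 0 _ (by lia)
  -- Cochain degree `-k` corresponds to chain degree `k`; the two three-term pieces are then
  -- identified.
  rw [HomologicalComplex.exactAt_iff' _ (-((n : ℤ) + 2)) (-((n : ℤ) + 1)) (-(n : ℤ)) (by simp; lia) (by simp)] at h
  rw [HomologicalComplex.exactAt_iff' _ (n + 2) (n + 1) n (by simp) (by simp)]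
  have hd : ∀ (i j : ℤ) (k l : ℕ) (hi : -k = i) (hj : -l = j),
      G.map (R.cochainComplexXIso i k hi).hom ≫ G.map (R.complex.d k l) =
        G.map (R.cochainComplex.d i j) ≫ G.map (R.cochainComplexXIso j l hj).hom := by
    intro i j k l hi hj
    rw [← G.map_comp, ← G.map_comp, R.cochainComplex_d i j k l hi hj]
    simp
  exact (ShortComplex.exact_iff_of_iso (ShortComplex.isoMk
    (G.mapIso (R.cochainComplexXIso (-((n : ℤ) + 2)) (n + 2) (by simp)))
    (G.mapIso (R.cochainComplexXIso (-((n : ℤ) + 1)) (n + 1) (by simp)))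
    (G.mapIso (R.cochainComplexXIso (-(n : ℤ)) n rfl)) (hd _ _ _ _ _ _) (hd _ _ _ _ _ _))).1 h

end

/-! ### Deriving `Ext` vanishing from conditions (a) and (d) -/

section

open Abelian

variable {A : Type u₁} [Category.{v₁} A] [Abelian A]
  {B : Type u₂} [Category.{v₂} B] [Abelian B]
  {F : B ⥤ A} {G : A ⥤ B} (adj : G ⊣ F) [G.Additive]

namespace CategoryTheory

/-- The image of a projective resolution by a right exact functor preserving projective objects
is a projective resolution if it is exact in positive degrees. -/
noncomputable def ProjectiveResolution.map {X : A} (R : ProjectiveResolution X) (G : A ⥤ B)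
    [G.Additive] [G.PreservesProjectiveObjects] [PreservesFiniteColimits G]
    (hR : ∀ n, ((G.mapHomologicalComplex (.down ℕ)).obj R.complex).ExactAt (n + 1)) :
    ProjectiveResolution (G.obj X) :=
  have w : G.map (R.complex.d 1 0) ≫ G.map (R.π.f 0) = 0 := by
    rw [← G.map_comp, R.complex_d_comp_π_f_zero, G.map_zero]
  { complex := (G.mapHomologicalComplex (.down ℕ)).obj R.complex
    projective n := G.projective_obj_of_projective (R.projective n)
    π := (ChainComplex.toSingle₀Equiv _ _).symm ⟨G.map (R.π.f 0), w⟩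
    quasiIso := ⟨fun n => by
      cases n with
      -- In degree 0 the claim is that `G` preserves the cokernel presenting `X`.
      | zero =>
        rw [ChainComplex.quasiIsoAt₀_iff, ShortComplex.quasiIso_iff_of_zeros']
        · have h := (ShortComplex.exact_and_epi_g_iff_g_is_cokernel (ShortComplex.mk
            (G.map (R.complex.d 1 0)) (G.map (R.π.f 0)) w)).2
            ⟨CokernelCofork.mapIsColimit _ R.isColimitCokernelCofork G⟩
          refine (ShortComplex.exact_and_epi_g_iff_of_iso ?_).2 h
          exact ShortComplex.isoMk (Iso.refl _) (Iso.refl _) (Iso.refl _)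
            ((Category.id_comp _).trans (Category.comp_id _).symm)
            (by
              have hπ := ChainComplex.toSingle₀Equiv_symm_apply_f_zero
                (C := (G.mapHomologicalComplex (.down ℕ)).obj R.complex) (X := G.obj X)
                (G.map (R.π.f 0)) w
              exact (Category.id_comp _).trans (hπ.symm.trans (Category.comp_id _).symm))
        · exact (congrArg _ (R.complex.shape _ _ (by simp))).trans (G.map_zero _ _)
        · rfl
        · rfl
      | succ n =>
        rw [quasiIsoAt_iff_exactAt']
        · exact hR n
        · exact ChainComplex.exactAt_succ_single_obj _ _⟩ }

include adj in
lemma Adjunction.subsingleton_ext_of_isZero_leftDerived [EnoughProjectives A] [HasExt.{w} A]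
    [F.PreservesEpimorphisms] [F.Full] [F.Faithful] (P : B) (hP : Projective P)
    (h : ∀ n : ℕ, IsZero ((G.leftDerived (n + 1)).obj (F.obj P))) (Y : B) (n : ℕ) :
    Subsingleton (Ext (F.obj P) (F.obj Y) (n + 1)) := by
  have : HasExt.{max u₂ v₂} B := HasExt.standard B
  have : G.PreservesProjectiveObjects :=
    Functor.preservesProjectiveObjects_of_adjunction_of_preservesEpimorphisms adj
  have : PreservesFiniteColimits G := by
    have : PreservesColimitsOfSize.{0, 0} G := adj.leftAdjoint_preservesColimits
    exact PreservesColimitsOfSize.preservesFiniteColimits G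
  let R := projectiveResolution (F.obj P)
  let R' := R.map G (fun n => (R.isZero_leftDerived_obj_iff G (n + 1)).1 (h n))
  have : Projective (G.obj (F.obj P)) := hP.of_iso (asIso (adj.counit.app P)).symm
  refine subsingleton_of_forall_eq 0 fun x => ?_
  obtain ⟨f, hf, rfl⟩ := R.extMk_surjective x (n + 2) rfl
  rw [R.extMk_eq_zero_iff f (n + 2) rfl hf n rfl]
  -- The adjoint cocycle is a coboundary because its source in B is projective; its primitive is
  -- transported back.
  let f' : R'.complex.X (n + 1) ⟶ Y := (adj.homEquiv _ _).symm f
  have hf' : R'.complex.d (n + 2) (n + 1) ≫ f' = 0 := by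
    refine (adj.homEquiv_naturality_left_symm _ _).symm.trans ?_
    rw [hf]
    exact (adj.homEquiv_counit _ _ _).trans (by rw [G.map_zero, zero_comp]; rfl)
  obtain ⟨g, hg⟩ := (R'.extMk_eq_zero_iff f' (n + 2) rfl hf' n rfl).1
    (Ext.eq_zero_of_projective _)
  refine ⟨adj.homEquiv _ _ g, ?_⟩
  exact (adj.homEquiv_naturality_left _ _).symm.trans
    ((congrArg _ hg).trans (Equiv.apply_symm_apply _ _))

end CategoryTheory

open DerivedCategory in
lemma CategoryTheory.Functor.subsingleton_ext_of_mapDerivedCategory_map_surjective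
    [HasExt.{w} A] [HasDerivedCategory.{w₁} A] [HasDerivedCategory.{w₂} B]
    (F : B ⥤ A) [F.Additive] [PreservesFiniteLimits F] [PreservesFiniteColimits F]
    (P Y : B) [Projective P] (n : ℕ)
    (h : Function.Surjective (F.mapDerivedCategory.map :
      ((singleFunctor B 0).obj P ⟶ ((singleFunctor B 0).obj Y)⟦((n + 1 : ℕ) : ℤ)⟧) → _)) :
    Subsingleton (Ext (F.obj P) (F.obj Y) (n + 1)) := by
  have : HasExt.{max u₂ v₂} B := HasExt.standard B
  refine subsingleton_of_forall_eq 0 fun x => ?_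
  let e := F.mapDerivedCategorySingleFunctor 0
  obtain ⟨β, hβ⟩ := h (e.hom.app P ≫ x.hom ≫ (e.inv.app Y)⟦((n + 1 : ℕ) : ℤ)⟧' ≫
    (F.mapDerivedCategory.commShiftIso _).inv.app _)
  have hx : x = (Ext.homEquiv.symm β).mapExactFunctor F := by
    ext
    rw [Ext.mapExactFunctor_hom, Ext.hom, Ext.hom, Equiv.apply_symm_apply, ShiftedHom.map, hβ]
    dsimp only [e]
    simp [← Functor.map_comp]
  rw [hx, Ext.eq_zero_of_projective (Ext.homEquiv.symm β), Ext.mapExactFunctor_zero]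

end

theorem mainTheorem6 {A : Type u} [Category.{v} A] [Abelian A]
    [EnoughProjectives A] (B : ObjectProperty A) [B.IsClosedUnderKernels]
    [B.IsClosedUnderCokernels] [Reflective B.ι]
    [HasDerivedCategory.{w₁} B.FullSubcategory] [HasDerivedCategory.{w₂} A] :
    List.TFAE
      [∀ P : B.FullSubcategory, Projective P → ∀ n : ℕ, 1 ≤ n →
          IsZero (((reflector B.ι).leftDerived n).obj P.obj),
        ∀ X : B.FullSubcategory, ∀ n : ℕ, 1 ≤ n →
          IsZero (((reflector B.ι).leftDerived n).obj X.obj),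
        (ReflectiveAbelian.mapDerivedMinus B.ι).Full ∧
          (ReflectiveAbelian.mapDerivedMinus B.ι).Faithful,
        (ReflectiveAbelian.mapDerivedBounded B.ι).Full ∧
          (ReflectiveAbelian.mapDerivedBounded B.ι).Faithful] := by
  have : HasExt.{max u v} A := HasExt.standard A
  let adj := reflectorAdjunction B.ι
  have ext_of_a : (∀ P : B.FullSubcategory, Projective P → ∀ n : ℕ, 1 ≤ n →
      IsZero (((reflector B.ι).leftDerived n).obj P.obj)) →
      ∀ P : B.FullSubcategory, Projective P → ∀ (Y : B.FullSubcategory) (n : ℕ),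
        Subsingleton (Abelian.Ext (B.ι.obj P) (B.ι.obj Y) (n + 1)) := fun h P hP =>
    adj.subsingleton_ext_of_isZero_leftDerived P hP (fun n => h P hP (n + 1) (by lia))
  tfae_have 2 → 1 := fun h P _ => h P
  tfae_have 1 → 2 := by
    intro h X n hn
    obtain ⟨n, rfl⟩ := Nat.exists_eq_add_of_le' hn
    exact adj.isZero_leftDerived_obj (ext_of_a h) X n
  tfae_have 1 → 3 := by
    intro h
    have hbij : ∀ X Y : DerivedCategory.Minus B.FullSubcategory, Function.Bijective
        (B.ι.mapDerivedCategory.map : (X.obj ⟶ Y.obj) → _) := fun X Y => by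
      obtain ⟨N, hN⟩ := X.property
      have : X.obj.IsLE N := hN
      exact adj.mapDerivedCategory_map_bijective_of_isLE (ext_of_a h) X.obj Y.obj N
    refine ⟨⟨fun {X Y} f => ?_⟩, ⟨fun {X Y} f g hfg => ?_⟩⟩
    · obtain ⟨g, hg⟩ := (hbij X Y).surjective f.hom
      exact ⟨ObjectProperty.homMk g, ObjectProperty.hom_ext _ hg⟩
    · exact ObjectProperty.hom_ext _ ((hbij X Y).injective
        (congrArg (fun φ => φ.hom) hfg))
  tfae_have 3 → 4 := by
    rintro ⟨_, _⟩
    let ι : DerivedCategory.Bounded B.FullSubcategory ⥤ DerivedCategory.Minus B.FullSubcategory :=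
      ObjectProperty.ιOfLE fun _ h => h.2
    refine ⟨⟨fun {X Y} f => ?_⟩, ⟨fun {X Y} f g hfg => ?_⟩⟩
    · obtain ⟨g, hg⟩ := (ReflectiveAbelian.mapDerivedMinus B.ι).map_surjective
        (X := ι.obj X) (Y := ι.obj Y) (ObjectProperty.homMk f.hom)
      exact ⟨ObjectProperty.homMk g.hom,
        ObjectProperty.hom_ext _ (congrArg (fun φ => φ.hom) hg)⟩
    · have h : ι.map f = ι.map g := (ReflectiveAbelian.mapDerivedMinus B.ι).map_injective
        (ObjectProperty.hom_ext _ (congrArg (fun φ => φ.hom) hfg))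
      exact ι.map_injective h
  tfae_have 4 → 1 := by
    rintro ⟨_, _⟩ P hP n hn
    obtain ⟨n, rfl⟩ := Nat.exists_eq_add_of_le' hn
    -- Only `Ext` vanishing is needed, and it concerns bounded objects: `P` and a shift of `Y`.
    refine adj.isZero_leftDerived_obj (fun P hP Y n => ?_) P n
    refine B.ι.subsingleton_ext_of_mapDerivedCategory_map_surjective P Y n fun f => ?_
    let t : Triangulated.TStructure (DerivedCategory B.FullSubcategory) :=
      DerivedCategory.TStructure.t
    have hs (X : B.FullSubcategory) :
        t.bounded ((DerivedCategory.singleFunctor B.FullSubcategory 0).obj X) :=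
      ⟨⟨0, inferInstance⟩, ⟨0, inferInstance⟩⟩
    let S : DerivedCategory.Bounded B.FullSubcategory := ⟨_, hs P⟩
    let T : DerivedCategory.Bounded B.FullSubcategory :=
      ⟨_, t.bounded.le_shift ((n + 1 : ℕ) : ℤ) _ (hs Y)⟩
    obtain ⟨g, hg⟩ := (ReflectiveAbelian.mapDerivedBounded B.ι).map_surjective
      (X := S) (Y := T) (ObjectProperty.homMk f)
    exact ⟨g.hom, congrArg (fun φ => φ.hom) hg⟩
  tfae_finish
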